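/- For a negative discriminant $D$ let $C(D)$ be the class group of primitive positive definite integral binary quadratic forms $(a,b,c)=ax^2+bxy+cy^2$ of discriminant $D=b^2-4ac$ up to proper equivalence ($f\sim g$ if $f(x,y)=g(A(x,y)^T)$ with $A\in SL_2(\mathbb Z)$), with Dirichlet composition as the group law. A class $f\in C(Dm^2)$ is \emph{derived} from $g\in C(D)$ if, for suitable representatives, $f(x,y)=g(A(x,y)^T)$ for some integer matrix $A$ with $\det A=m$. For $r=\prod_i p_i^{e_i}$ put $\varphi_D(r)=\prod_i p_i^{e_i-1}\bigl(p_i-\left(\tfrac{D}{p_i}\right)\bigr)$ with the Kronecker symbol $\left(\tfrac{D}{p}\right)$; in particular $\varphi_D(r)=r-\left(\tfrac{D}{r}\right)$ if $r$ is prime. Let $n=a^2b$ with positive integers $a,b$, and let $r$ be a prime with $\gcd(r,a)=1$. Suppose that $f_1,f_2\in C(-4n)$ are derived from the same form in $C(-4b)$. Let $g_1,g_2\in C(-4nr^2)$ be lifts of $f_1,f_2$, that is, $g_i$ is derived from $f_i$, and let $h_i=g_i^{\varphi_{-4n}(r)}$ for $i=1,2$. If $h_i\sim(a_i,b_i,c_i)$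 for $i=1,2$, then the form $x^2+br^2y^2$ represents $a_1a_2$, i.e. there are integers $x,y$ with $x^2+br^2y^2=a_1a_2$. -/

import Mathlib

/-- An integral binary quadratic form `a x² + b x y + c y²`, written `(a, b, c)`. -/
@[ext]
structure BinForm where
  a : ℤ
  b : ℤ
  c : ℤ

namespace BinForm

/-- The value `f(x, y)`. -/
def eval (f : BinForm) (x y : ℤ) : ℤ :=
  f.a * x ^ 2 + f.b * x * y + f.c * y ^ 2

def disc (f : BinForm) : ℤ := f.b ^ 2 - 4 * f.a * f.c

/-- The coefficients have no common divisor. -/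
def IsPrimitive (f : BinForm) : Prop :=
  ∀ d : ℤ, d ∣ f.a → d ∣ f.b → d ∣ f.c → IsUnit d

/-- `f` represents `m`. -/
def Represents (f : BinForm) (m : ℤ) : Prop := ∃ x y : ℤ, f.eval x y = m

/-- `f(x, y) = g(A (x, y)ᵀ)` for the integer matrix `A`. -/
def IsTransform (A : Matrix (Fin 2) (Fin 2) ℤ) (f g : BinForm) : Prop :=
  ∀ x y : ℤ, f.eval x y = g.eval (A 0 0 * x + A 0 1 * y) (A 1 0 * x + A 1 1 * y)

/-- Proper equivalence of forms: `f(x, y) = g(A (x, y)ᵀ)` with `det A = 1`. -/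
def Equivalent (f g : BinForm) : Prop :=
  ∃ A : Matrix (Fin 2) (Fin 2) ℤ, A.det = 1 ∧ IsTransform A f g

theorem Equivalent.refl (f : BinForm) : Equivalent f f :=
  ⟨1, by simp, fun x y => by simp⟩

theorem Equivalent.symm {f g : BinForm} (h : Equivalent f g) : Equivalent g f := by
  obtain ⟨A, hA, h⟩ := h
  rw [Matrix.det_fin_two] at hA
  refine ⟨!![A 1 1, -A 0 1; -A 1 0, A 0 0], ?_, fun x y => ?_⟩
  · rw [Matrix.det_fin_two]
    simp
    linarith
  · rw [h]
    congr 1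
    · simp
      linear_combination (-x) * hA
    · simp
      linear_combination (-y) * hA

theorem Equivalent.trans {f g k : BinForm} (h₁ : Equivalent f g) (h₂ : Equivalent g k) :
    Equivalent f k := by
  obtain ⟨A, hA, h₁⟩ := h₁
  obtain ⟨B, hB, h₂⟩ := h₂
  refine ⟨B * A, by rw [Matrix.det_mul, hA, hB, one_mul], fun x y => ?_⟩
  rw [h₁, h₂]
  congr 1 <;> simp [Matrix.mul_apply, Fin.sum_univ_two] <;> ring

/-- The principal form `x² + m y²`, of discriminant `-4 m`. -/
def principal (m : ℤ) : BinForm := ⟨1, 0, m⟩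

end BinForm

/-- The primitive forms of discriminant `D` with positive leading coefficient; for `D < 0` these
are the primitive positive definite forms of discriminant `D`. -/
def PrimForm (D : ℤ) : Type :=
  {f : BinForm // f.disc = D ∧ f.IsPrimitive ∧ 0 < f.a}

instance PrimForm.setoid (D : ℤ) : Setoid (PrimForm D) where
  r f g := BinForm.Equivalent f.1 g.1
  iseqv := ⟨fun f => BinForm.Equivalent.refl f.1, fun h => h.symm, fun h₁ h₂ => h₁.trans h₂⟩

/-- The underlying set of the class group `C(D)`, for `D < 0`: proper equivalence classes of
primitive positive definite forms of discriminant `D`. -/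
def FormClass (D : ℤ) : Type := Quotient (PrimForm.setoid D)

/-- The class of a form. -/
def PrimForm.toClass {D : ℤ} (f : PrimForm D) : FormClass D := Quotient.mk _ f

/-- The class `F` is derived from the class `G` by a transformation of determinant `r`: suitable
representatives satisfy `f(x, y) = g(A (x, y)ᵀ)` with `det A = r`. (The discriminants then satisfy
`D' = D r²`.) -/
def FormClass.IsDerived {D' D : ℤ} (r : ℤ) (F : FormClass D') (G : FormClass D) : Prop :=
  ∃ (f : PrimForm D') (g : PrimForm D) (A : Matrix (Fin 2) (Fin 2) ℤ),
    f.toClass = F ∧ g.toClass = G ∧ A.det = r ∧ BinForm.IsTransform A f.1 g.1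

/-- `h` is a Dirichlet composition of `f = (a₁, b₁, c₁)` and `g = (a₂, b₂, c₂)`, where
`gcd(a₁, a₂, (b₁ + b₂) / 2) = 1`: `h = (a₁ a₂, B, (B² - D) / (4 a₁ a₂))` with
`B ≡ b₁ mod 2 a₁`, `B ≡ b₂ mod 2 a₂` and `B² ≡ D mod 4 a₁ a₂`. The last congruence and the third
coefficient are implied by `h` having discriminant `D`; the division by two is exact, since both
`bᵢ` have the parity of `D`. -/
def PrimForm.IsDirichletComp {D : ℤ} (f g h : PrimForm D) : Prop :=
  Int.gcd (Int.gcd f.1.a g.1.a) ((f.1.b + g.1.b) / 2) = 1 ∧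
    h.1.a = f.1.a * g.1.a ∧
    h.1.b ≡ f.1.b [ZMOD 2 * f.1.a] ∧
    h.1.b ≡ g.1.b [ZMOD 2 * g.1.a]

/-- `H` is the product `F · G` in `C(D)`: the class of a Dirichlet composition of representatives
of `F` and `G`. -/
def FormClass.IsProduct {D : ℤ} (F G H : FormClass D) : Prop :=
  ∃ f g h : PrimForm D,
    f.toClass = F ∧ g.toClass = G ∧ h.toClass = H ∧ f.IsDirichletComp g h

/-- `G.IsPow k H`: `H = G ^ k` in `C(D)`, for exponents `k ≥ 1`. -/
inductive FormClass.IsPow {D : ℤ} (G : FormClass D) : ℕ → FormClass D → Prop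
  | one : FormClass.IsPow G 1 G
  | succ {k : ℕ} {H H' : FormClass D} :
      FormClass.IsPow G k H → FormClass.IsProduct H G H' → FormClass.IsPow G (k + 1) H'

/-- The Kronecker symbol `(D / p)` for a prime `p`. At `p = 2` it is `0` for even `D`, `1` for
`D ≡ ±1 mod 8` and `-1` for `D ≡ ±3 mod 8`. -/
def kroneckerPrime (D : ℤ) (p : ℕ) : ℤ :=
  if p = 2 then ZMod.χ₈ (D : ZMod 8) else jacobiSym D p

/-- `φ_D(r) = ∏ p ^ (e - 1) (p - (D / p))` over the prime powers `p ^ e` exactly dividing `r`.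
Each factor `p - (D / p)` is positive, so `Int.toNat` loses nothing. -/
def phiDisc (D : ℤ) (r : ℕ) : ℕ :=
  ∏ p ∈ r.primeFactors, p ^ (r.factorization p - 1) * ((p : ℤ) - kroneckerPrime D p).toNat

/-!
The class group of discriminant `-4 b m²` is realised by lattices in `ℂ` up to homothety. A form
`(A, B, C)` gives the lattice `ℤ A + ℤ (B / 2 + m √-b)`, which is invertible over the order
`ℤ[m √-b]`, its inverse being the conjugate lattice up to the norm `A`
(`BinForm.lattice_mul_conjLattice`). Dirichlet composition becomes multiplication of lattices
(`PrimForm.IsDirichletComp.lattice_mul`), and the class from which a given one is derived is that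
of its lattice extended to the larger order (`BinForm.IsTransform.homothetic`). Lattices are
`ℤ`-submodules of `ℂ`, so these statements are identities in a commutative semiring.

The lattices of `g₁` and `g₂` have homothetic extensions to `ℤ[√-b]`, since both classes lie over
the same class of discriminant `-4 b`. Hence their quotient, extended to `ℤ[r √-b]`, is an
invertible lattice `I` whose extension to `ℤ[√-b]` is principal. Such an `I` contains an element
that is a unit modulo `r`, after scaling, and the `φ(r)`-th power of a unit of `ℤ[√-b] / r` is an
integer modulo `r` by Frobenius (`exists_natCast_dvd_pow_phiDisc_sub`). As `I ^ φ(r)` also contains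
`r ℤ[√-b]`, it is principal (`order_mul_pow_phiDisc`). So the lattices of `h₁` and `h₂` become
homothetic over `ℤ[r √-b]`, which is to say that `h₁` and `h₂` are derived from the same class of
discriminant `-4 b r²`. The leading coefficients of forms over the same class multiply to a norm
`x² + b r² y²` from `ℤ[r √-b]` (`represents_of_homothetic`).
-/

/-! ### Lattices in the complex numbers -/

/-- The subgroup `ℤ z` of `ℂ`; multiplying a lattice by it scales the lattice by `z`. -/
def multiples (z : ℂ) : Submodule ℤ ℂ := Submodule.span ℤ {z}

theorem mem_multiples_mul {z x : ℂ} {L : Submodule ℤ ℂ} :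
    x ∈ multiples z * L ↔ ∃ y ∈ L, z * y = x :=
  Submodule.mem_span_singleton_mul

theorem multiples_mul_mem {z x : ℂ} {L : Submodule ℤ ℂ} (hx : x ∈ L) :
    z * x ∈ multiples z * L :=
  mem_multiples_mul.2 ⟨x, hx, rfl⟩

theorem multiples_mul (z w : ℂ) : multiples (z * w) = multiples z * multiples w := by
  simp [multiples, Submodule.span_mul_span]

theorem multiples_one : multiples 1 = 1 := Submodule.one_eq_span.symm

theorem multiples_pow (z : ℂ) (k : ℕ) : multiples (z ^ k) = multiples z ^ k := by
  induction k with
  | zero => simp [multiples_one]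
  | succ k ih => rw [pow_succ, pow_succ, multiples_mul, ih]

theorem multiples_inv_mul {z : ℂ} (hz : z ≠ 0) : multiples z⁻¹ * multiples z = 1 := by
  rw [← multiples_mul, inv_mul_cancel₀ hz, multiples_one]

theorem multiples_mul_cancel {z : ℂ} (hz : z ≠ 0) {L M : Submodule ℤ ℂ}
    (h : multiples z * L = multiples z * M) : L = M := by
  rw [← one_mul L, ← one_mul M, ← multiples_inv_mul hz, mul_assoc, h, mul_assoc]

/-- `L = z M` for some complex number `z ≠ 0`. -/
def Homothetic (L M : Submodule ℤ ℂ) : Prop := ∃ z : ℂ, z ≠ 0 ∧ L = multiples z * M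

namespace Homothetic

variable {L M N L' M' : Submodule ℤ ℂ}

theorem refl (L : Submodule ℤ ℂ) : Homothetic L L :=
  ⟨1, one_ne_zero, by rw [multiples_one, one_mul]⟩

theorem symm (h : Homothetic L M) : Homothetic M L := by
  obtain ⟨z, hz, rfl⟩ := h
  exact ⟨z⁻¹, inv_ne_zero hz, by rw [← mul_assoc, multiples_inv_mul hz, one_mul]⟩

theorem trans (h : Homothetic L M) (h' : Homothetic M N) : Homothetic L N := by
  obtain ⟨z, hz, rfl⟩ := h
  obtain ⟨w, hw, rfl⟩ := h'
  exact ⟨z * w, mul_ne_zero hz hw, by rw [multiples_mul, mul_assoc]⟩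

theorem mul (h : Homothetic L M) (h' : Homothetic L' M') : Homothetic (L * L') (M * M') := by
  obtain ⟨z, hz, rfl⟩ := h
  obtain ⟨w, hw, rfl⟩ := h'
  exact ⟨z * w, mul_ne_zero hz hw, by rw [multiples_mul]; ring⟩

end Homothetic

/-- Complex conjugation of lattices. -/
noncomputable def conjLattice : Submodule ℤ ℂ →+* Submodule ℤ ℂ :=
  Submodule.mapHom (starRingEnd ℂ).toIntAlgHom

theorem conjLattice_span (s : Set ℂ) :
    conjLattice (Submodule.span ℤ s) = Submodule.span ℤ (starRingEnd ℂ '' s) :=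
  Submodule.map_span _ _

theorem conjLattice_multiples (z : ℂ) :
    conjLattice (multiples z) = multiples (starRingEnd ℂ z) := by
  simp [multiples, conjLattice_span]

theorem conjLattice_mono {L M : Submodule ℤ ℂ} (h : L ≤ M) : conjLattice L ≤ conjLattice M :=
  Submodule.map_mono h

theorem conj_mem_conjLattice {L : Submodule ℤ ℂ} {x : ℂ} (hx : x ∈ L) :
    starRingEnd ℂ x ∈ conjLattice L :=
  Submodule.mem_map_of_mem hx

/-! ### The orders `ℤ[m √-b]` and the lattice of a form -/

/-- The square root `√-b` in the upper half plane. -/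
noncomputable def sqrtNeg (b : ℕ) : ℂ := Complex.I * (Real.sqrt b : ℝ)

theorem sqrtNeg_sq (b : ℕ) : sqrtNeg b ^ 2 = -(b : ℂ) := by
  rw [sqrtNeg, mul_pow, Complex.I_sq, ← Complex.ofReal_pow, Real.sq_sqrt (Nat.cast_nonneg b)]
  simp

theorem conj_sqrtNeg (b : ℕ) : starRingEnd ℂ (sqrtNeg b) = -sqrtNeg b := by
  simp [sqrtNeg]

/-- The order `ℤ[m √-b]`, of discriminant `-4 b m²`. -/
noncomputable def order (b : ℕ) (m : ℤ) : Submodule ℤ ℂ :=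
  Submodule.span ℤ {1, m * sqrtNeg b}

theorem mem_order {b : ℕ} {m : ℤ} {z : ℂ} :
    z ∈ order b m ↔ ∃ x y : ℤ, z = x + y * (m * sqrtNeg b) := by
  simp only [order, Submodule.mem_span_pair, zsmul_eq_mul, mul_one, eq_comm]

theorem intCast_mem_order (b : ℕ) (m k : ℤ) : (k : ℂ) ∈ order b m :=
  mem_order.2 ⟨k, 0, by simp⟩

theorem one_mem_order (b : ℕ) (m : ℤ) : (1 : ℂ) ∈ order b m :=
  mem_order.2 ⟨1, 0, by simp⟩

theorem mul_mem_order {b : ℕ} {m : ℤ} {z w : ℂ} (hz : z ∈ order b m) (hw : w ∈ order b m) :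
    z * w ∈ order b m := by
  obtain ⟨x, y, rfl⟩ := mem_order.1 hz
  obtain ⟨u, v, rfl⟩ := mem_order.1 hw
  refine mem_order.2 ⟨x * u - y * v * m ^ 2 * b, x * v + y * u, ?_⟩
  push_cast
  linear_combination ((y : ℂ) * v * m ^ 2) * sqrtNeg_sq b

theorem order_le_order (b : ℕ) {m k : ℤ} (h : k ∣ m) : order b m ≤ order b k := by
  obtain ⟨t, rfl⟩ := h
  intro z hz
  obtain ⟨x, y, rfl⟩ := mem_order.1 hz
  exact mem_order.2 ⟨x, y * t, by push_cast; ring⟩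

theorem one_le_order (b : ℕ) (m : ℤ) : 1 ≤ order b m :=
  Submodule.one_le.2 (one_mem_order b m)

theorem order_mul_order (b : ℕ) {m k : ℤ} (h : k ∣ m) : order b m * order b k = order b k := by
  apply le_antisymm
  · exact Submodule.mul_le.2 fun x hx y hy => mul_mem_order (order_le_order b h hx) hy
  · calc order b k = 1 * order b k := (one_mul _).symm
      _ ≤ _ := mul_le_mul_left (one_le_order b m) _

theorem conjLattice_order (b : ℕ) (m : ℤ) : conjLattice (order b m) = order b m := by
  have h : conjLattice (order b m) = Submodule.span ℤ {1, -(m * sqrtNeg b)} := by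
    simp [order, conjLattice_span, Set.image_pair, conj_sqrtNeg]
  rw [h]
  ext z
  simp only [order, Submodule.mem_span_pair, zsmul_eq_mul]
  constructor <;>
  · rintro ⟨x, y, rfl⟩
    exact ⟨x, -y, by push_cast; ring⟩

namespace BinForm

/-- The lattice `ℤ a + ℤ (b / 2 + m √-b₀)` attached to a form `(a, b, c)` of discriminant
`-4 b₀ m²`; then `f(x, y) = |a x + (b / 2 + m √-b₀) y|² / a`. -/
noncomputable def lattice (b : ℕ) (m : ℤ) (f : BinForm) : Submodule ℤ ℂ :=
  Submodule.span ℤ {(f.a : ℂ), (f.b : ℂ) / 2 + m * sqrtNeg b}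

variable {b : ℕ} {m : ℤ} {f g : BinForm}

theorem mem_lattice {z : ℂ} :
    z ∈ f.lattice b m ↔ ∃ x y : ℤ, z = x * f.a + y * ((f.b : ℂ) / 2 + m * sqrtNeg b) := by
  simp only [lattice, Submodule.mem_span_pair, zsmul_eq_mul, eq_comm]

theorem a_mem_lattice (b : ℕ) (m : ℤ) (f : BinForm) : (f.a : ℂ) ∈ f.lattice b m :=
  mem_lattice.2 ⟨1, 0, by simp⟩

theorem exists_middle_eq_two_mul (hf : f.disc = -4 * b * m ^ 2) :
    ∃ k : ℤ, (f.b : ℂ) = 2 * k ∧ (k : ℂ) ^ 2 + b * m ^ 2 = f.a * f.c := by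
  rw [disc] at hf
  have h : (2 : ℤ) ∣ f.b ^ 2 := ⟨2 * f.a * f.c - 2 * b * m ^ 2, by linear_combination hf⟩
  obtain ⟨k, hk⟩ := Int.prime_two.dvd_of_dvd_pow h
  rw [hk] at hf ⊢
  have h' : k ^ 2 + b * m ^ 2 = f.a * f.c := by linarith
  exact ⟨k, by push_cast; ring, mod_cast h'⟩

theorem IsPrimitive.exists_bezout (hf : f.IsPrimitive) :
    ∃ x y z : ℤ, f.a * x + f.b * y + f.c * z = 1 := by
  have h1 : IsUnit ((Int.gcd (Int.gcd f.a f.b) f.c : ℕ) : ℤ) := by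
    apply hf
    · exact (Int.gcd_dvd_left ..).trans (Int.gcd_dvd_left ..)
    · exact (Int.gcd_dvd_left ..).trans (Int.gcd_dvd_right ..)
    · exact Int.gcd_dvd_right ..
  have h2 : Int.gcd (Int.gcd f.a f.b) f.c = 1 := by
    simpa using Int.isUnit_iff_natAbs_eq.1 h1
  have h3 := Int.gcd_eq_gcd_ab (Int.gcd f.a f.b) f.c
  have h4 := Int.gcd_eq_gcd_ab f.a f.b
  rw [h2, Nat.cast_one] at h3
  refine ⟨Int.gcdA f.a f.b * Int.gcdA (Int.gcd f.a f.b) f.c,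
    Int.gcdB f.a f.b * Int.gcdA (Int.gcd f.a f.b) f.c, Int.gcdB (Int.gcd f.a f.b) f.c, ?_⟩
  linear_combination -h3 - Int.gcdA (Int.gcd f.a f.b) f.c * h4

/-- The lattice of a primitive form is invertible over its order, and the leading coefficient is
its norm. -/
theorem lattice_mul_conjLattice (hf : f.disc = -4 * b * m ^ 2) (hp : f.IsPrimitive) :
    f.lattice b m * conjLattice (f.lattice b m) = multiples f.a * order b m := by
  obtain ⟨k, hb, hk⟩ := exists_middle_eq_two_mul hf
  have hn : ((k : ℂ) + m * sqrtNeg b) * (k - m * sqrtNeg b) = f.a * f.c := by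
    linear_combination hk - (m : ℂ) ^ 2 * sqrtNeg_sq b
  have hconj : conjLattice (f.lattice b m) =
      Submodule.span ℤ {(f.a : ℂ), (k : ℂ) - m * sqrtNeg b} := by
    rw [lattice, conjLattice_span, Set.image_pair, hb, mul_div_cancel_left₀ _ two_ne_zero]
    simp [conj_sqrtNeg, sub_eq_add_neg]
  have hlat : f.lattice b m = Submodule.span ℤ {(f.a : ℂ), (k : ℂ) + m * sqrtNeg b} := by
    rw [lattice, hb, mul_div_cancel_left₀ _ two_ne_zero]
  rw [hconj, hlat]
  apply le_antisymm
  · rw [Submodule.span_mul_span, Submodule.span_le]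
    rintro _ ⟨x, hx, y, hy, rfl⟩
    rw [SetLike.mem_coe, mem_multiples_mul]
    rcases hx with rfl | rfl <;> rcases hy with rfl | rfl
    · exact ⟨f.a, intCast_mem_order b m _, rfl⟩
    · exact ⟨_, mem_order.2 ⟨k, -1, rfl⟩, by push_cast; ring⟩
    · exact ⟨_, mem_order.2 ⟨k, 1, rfl⟩, by push_cast; ring⟩
    · exact ⟨f.c, intCast_mem_order b m _, hn.symm⟩
  · have key {x y : ℂ} (hx : x ∈ ({(f.a : ℂ), (k : ℂ) + m * sqrtNeg b} : Set ℂ))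
        (hy : y ∈ ({(f.a : ℂ), (k : ℂ) - m * sqrtNeg b} : Set ℂ)) :=
      Submodule.mul_mem_mul (Submodule.subset_span (R := ℤ) hx) (Submodule.subset_span (R := ℤ) hy)
    have haa := key (x := f.a) (y := f.a) (by simp) (by simp)
    have hab := key (x := f.a) (y := k - m * sqrtNeg b) (by simp) (by simp)
    have hba := key (x := k + m * sqrtNeg b) (y := f.a) (by simp) (by simp)
    have hbb := key (x := k + m * sqrtNeg b) (y := k - m * sqrtNeg b) (by simp) (by simp)
    obtain ⟨x, y, z, h⟩ := hp.exists_bezout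
    have h' : (f.a : ℂ) * x + 2 * k * y + f.c * z = 1 := by
      rw [← hb]
      exact mod_cast h
    have h1 := add_mem (add_mem (Submodule.smul_mem _ x haa)
      (Submodule.smul_mem _ y (add_mem hab hba))) (Submodule.smul_mem _ z hbb)
    intro w hw
    obtain ⟨w', hw', rfl⟩ := mem_multiples_mul.1 hw
    obtain ⟨u, v, rfl⟩ := mem_order.1 hw'
    have h2 := add_mem (Submodule.smul_mem _ (u - v * k) h1) (Submodule.smul_mem _ v hba)
    convert h2 using 1
    simp only [zsmul_eq_mul]
    push_cast
    linear_combination (-((u : ℂ) - v * k) * z) * hn - ((u : ℂ) - v * k) * f.a * h'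

/-- The lattice of a form is a module over its order. -/
theorem lattice_mul_order (hf : f.disc = -4 * b * m ^ 2) :
    f.lattice b m * order b m = f.lattice b m := by
  obtain ⟨k, hb, hn⟩ := exists_middle_eq_two_mul hf
  apply le_antisymm
  · refine Submodule.mul_le.2 fun z hz w hw => ?_
    obtain ⟨x, y, rfl⟩ := mem_lattice.1 hz
    obtain ⟨u, v, rfl⟩ := mem_order.1 hw
    refine mem_lattice.2 ⟨x * (u - k * v) - y * v * f.c, y * u + x * v * f.a + y * v * k, ?_⟩
    rw [hb]
    push_cast
    linear_combination ((y : ℂ) * v * m ^ 2) * sqrtNeg_sq b - (y : ℂ) * v * hn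
  · calc f.lattice b m = f.lattice b m * 1 := (mul_one _).symm
      _ ≤ _ := mul_le_mul_right (one_le_order b m) _

/-- If `f = g ∘ A`, the lattice of `f` is homothetic to the image of `A` in the lattice of `g`,
hence to a sublattice of it. The multiplier is normalised so that norms can be compared. -/
theorem IsTransform.exists_multiples_mul_lattice_le {A : Matrix (Fin 2) (Fin 2) ℤ} {D : ℤ}
    (h : IsTransform A f g) (hA : A.det = D)
    (hg : g.disc = -4 * b * m ^ 2) (hfa : f.a ≠ 0) (hga : g.a ≠ 0) :
    ∃ z : ℂ, z * starRingEnd ℂ z * f.a = g.a ∧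
      multiples z * f.lattice b (D * m) ≤ g.lattice b m := by
  obtain ⟨k, hb, hn⟩ := exists_middle_eq_two_mul hg
  rw [Matrix.det_fin_two] at hA
  have h10 := h 1 0
  have h01 := h 0 1
  have h11 := h 1 1
  simp only [eval] at h10 h01 h11
  generalize A 0 0 = p at *
  generalize A 0 1 = q at *
  generalize A 1 0 = s at *
  generalize A 1 1 = t at *
  have ha : f.a = g.a * p ^ 2 + g.b * p * s + g.c * s ^ 2 := by linear_combination h10
  have hB : f.b = 2 * g.a * p * q + g.b * (p * t + q * s) + 2 * g.c * s * t := by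
    linear_combination h11 - h10 - h01
  have ha' : (f.a : ℂ) = g.a * p ^ 2 + 2 * k * p * s + g.c * s ^ 2 := by
    rw [ha, ← hb]; push_cast; ring
  have hB' : (f.b : ℂ) = 2 * (g.a * p * q + k * (p * t + q * s) + g.c * s * t) := by
    rw [hB]; push_cast; rw [hb]; ring
  have hA' : (p : ℂ) * t - q * s = D := mod_cast hA
  have hfa' : (f.a : ℂ) ≠ 0 := mod_cast hfa
  have hga' : (g.a : ℂ) ≠ 0 := mod_cast hga
  -- the image under `A` of the first basis vector
  set α : ℂ := p * g.a + s * (k + m * sqrtNeg b) with hα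
  have hαc : starRingEnd ℂ α = p * g.a + s * (k - m * sqrtNeg b) := by
    simp [hα, conj_sqrtNeg, sub_eq_add_neg]
  have hαα : α * starRingEnd ℂ α = g.a * f.a := by
    rw [hαc, ha', hα]
    linear_combination (s : ℂ) ^ 2 * hn - (s : ℂ) ^ 2 * m ^ 2 * sqrtNeg_sq b
  have hαβ : α * ((f.b : ℂ) / 2 + (D * m : ℤ) * sqrtNeg b) =
      f.a * (q * g.a + t * (k + m * sqrtNeg b)) := by
    have h0 : starRingEnd ℂ α ≠ 0 := fun h0 => by
      rw [h0, mul_zero] at hαα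
      exact mul_ne_zero hga' hfa' hαα.symm
    apply mul_left_cancel₀ h0
    apply mul_left_cancel₀ hga'
    have e : starRingEnd ℂ α * (q * g.a + t * (k + m * sqrtNeg b)) =
        g.a * ((f.b : ℂ) / 2 + (D * m : ℤ) * sqrtNeg b) := by
      rw [hαc, hB', ← hA]
      push_cast
      linear_combination (s : ℂ) * t * hn - (s : ℂ) * t * m ^ 2 * sqrtNeg_sq b
    linear_combination (g.a : ℂ) * ((f.b : ℂ) / 2 + (D * m : ℤ) * sqrtNeg b) * hαα -
      (g.a : ℂ) * f.a * e
  refine ⟨α / f.a, ?_, ?_⟩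
  · rw [map_div₀, map_intCast]
    field_simp
    linear_combination hαα
  · intro w hw
    obtain ⟨w', hw', rfl⟩ := mem_multiples_mul.1 hw
    obtain ⟨x, y, rfl⟩ := mem_lattice.1 hw'
    refine mem_lattice.2 ⟨x * p + y * q, x * s + y * t, ?_⟩
    rw [hb, mul_div_cancel_left₀ _ two_ne_zero, div_mul_eq_mul_div, div_eq_iff hfa']
    push_cast at hαβ ⊢
    linear_combination (y : ℂ) * hαβ + (x : ℂ) * f.a * hα

end BinForm

/-! ### Derivation and composition in terms of lattices -/

theorem le_of_multiples_mul_le {z : ℂ} (hz : z ≠ 0) {L M : Submodule ℤ ℂ}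
    (h : multiples z * L ≤ multiples z * M) : L ≤ M := by
  rw [← one_mul L, ← one_mul M, ← multiples_inv_mul hz, mul_assoc, mul_assoc]
  exact mul_le_mul_right h _

namespace BinForm

variable {b : ℕ} {m D : ℤ} {f g h : BinForm}

/-- If the primitive form `f` is `g ∘ A`, extending the lattice of `f` to the order of `g` gives
the lattice of `g` up to homothety: one lattice contains the other, and their norms agree. -/
theorem IsTransform.homothetic {A : Matrix (Fin 2) (Fin 2) ℤ} (h : IsTransform A f g)
    (hA : A.det = D) (hf : f.disc = -4 * b * (D * m) ^ 2) (hfp : f.IsPrimitive) (hfa : 0 < f.a)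
    (hg : g.disc = -4 * b * m ^ 2) (hgp : g.IsPrimitive) (hga : 0 < g.a) :
    Homothetic (f.lattice b (D * m) * order b m) (g.lattice b m) := by
  obtain ⟨z, hz, hle⟩ := h.exists_multiples_mul_lattice_le hA hg hfa.ne' hga.ne'
  have hga' : (g.a : ℂ) ≠ 0 := mod_cast hga.ne'
  have hz0 : z ≠ 0 := by
    rintro rfl
    simp only [zero_mul] at hz
    exact hga' hz.symm
  set P := multiples z * (f.lattice b (D * m) * order b m) with hP
  have hPle : P ≤ g.lattice b m := by
    rw [← lattice_mul_order hg, hP, ← mul_assoc]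
    exact mul_le_mul_left hle _
  have hPP : P * conjLattice P = multiples g.a * order b m := by
    calc P * conjLattice P
        = multiples (z * starRingEnd ℂ z) *
            (f.lattice b (D * m) * conjLattice (f.lattice b (D * m))) *
            (order b m * order b m) := by
          simp only [hP, map_mul, conjLattice_multiples, conjLattice_order, multiples_mul]
          ring
      _ = multiples (z * starRingEnd ℂ z * f.a) *
            (order b (D * m) * (order b m * order b m)) := by
          rw [lattice_mul_conjLattice hf hfp, multiples_mul (z * _)]
          ring
      _ = multiples g.a * order b m := by
          rw [hz, order_mul_order b dvd_rfl, order_mul_order b (dvd_mul_left m D)]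
  have hge : g.lattice b m ≤ P := by
    apply le_of_multiples_mul_le hga'
    calc multiples g.a * g.lattice b m = g.lattice b m * (P * conjLattice P) := by
          rw [hPP, ← lattice_mul_order hg]
          conv_lhs => rw [← order_mul_order b (dvd_refl m)]
          ring
      _ ≤ g.lattice b m * (P * conjLattice (g.lattice b m)) :=
          mul_le_mul_right (mul_le_mul_right (conjLattice_mono hPle) _) _
      _ = P * (g.lattice b m * conjLattice (g.lattice b m)) := by ring
      _ = multiples g.a * P := by
          rw [lattice_mul_conjLattice hg hgp, hP]
          conv_rhs => rw [← order_mul_order b (dvd_refl m)]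
          ring
  exact Homothetic.symm ⟨z, hz0, le_antisymm hge hPle⟩

end BinForm

namespace PrimForm

open BinForm

variable {D : ℤ} {b : ℕ} {m : ℤ}

theorem homothetic_of_toClass_eq {f g : PrimForm D} (hD : D = -4 * b * m ^ 2)
    (h : f.toClass = g.toClass) : Homothetic (f.1.lattice b m) (g.1.lattice b m) := by
  obtain ⟨A, hA, hfg⟩ : Equivalent f.1 g.1 := Quotient.exact h
  have h' := hfg.homothetic (b := b) (m := m) hA (by rw [one_mul, f.2.1, hD]) f.2.2.1 f.2.2.2
    (by rw [g.2.1, hD]) g.2.2.1 g.2.2.2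
  rwa [one_mul, lattice_mul_order (by rw [f.2.1, hD])] at h'

/-- Dirichlet composition is multiplication of lattices. -/
theorem IsDirichletComp.lattice_mul {f g h : PrimForm D} (hD : D = -4 * b * m ^ 2)
    (hc : f.IsDirichletComp g h) :
    f.1.lattice b m * g.1.lattice b m = h.1.lattice b m := by
  obtain ⟨hgcd, ha, hf, hg⟩ := hc
  obtain ⟨s, hs⟩ := hf.symm.dvd
  obtain ⟨t, ht⟩ := hg.symm.dvd
  obtain ⟨k, hk, hn⟩ := exists_middle_eq_two_mul (f := h.1) (b := b) (m := m) (by rw [h.2.1, hD])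
  have hk' : h.1.b = 2 * k := mod_cast hk
  have ha' : (h.1.a : ℂ) = f.1.a * g.1.a := mod_cast ha
  have hfb : (f.1.b : ℂ) / 2 = k - f.1.a * s := by
    have : f.1.b = 2 * (k - f.1.a * s) := by linear_combination hk' - hs
    rw [this]
    push_cast
    ring
  have hgb : (g.1.b : ℂ) / 2 = k - g.1.a * t := by
    have : g.1.b = 2 * (k - g.1.a * t) := by linear_combination hk' - ht
    rw [this]
    push_cast
    ring
  have hhb : (h.1.b : ℂ) / 2 = k := by rw [hk]; ring
  have hmid : (f.1.b + g.1.b) / 2 = 2 * k - f.1.a * s - g.1.a * t :=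
    Int.ediv_eq_of_eq_mul_right two_ne_zero (by linear_combination 2 * hk' - hs - ht)
  obtain ⟨x, y, z, hxyz⟩ : ∃ x y z : ℤ, f.1.a * x + g.1.a * y + 2 * k * z = 1 := by
    have h1 := Int.gcd_eq_gcd_ab f.1.a g.1.a
    have h2 := Int.gcd_eq_gcd_ab (Int.gcd f.1.a g.1.a) ((f.1.b + g.1.b) / 2)
    rw [hgcd, hmid, Nat.cast_one] at h2
    generalize Int.gcdA (Int.gcd f.1.a g.1.a) (2 * k - f.1.a * s - g.1.a * t) = p at h2
    generalize Int.gcdB (Int.gcd f.1.a g.1.a) (2 * k - f.1.a * s - g.1.a * t) = q at h2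
    refine ⟨Int.gcdA f.1.a g.1.a * p - s * q, Int.gcdB f.1.a g.1.a * p - t * q, q, ?_⟩
    linear_combination -h2 - p * h1
  have hxyz' : (f.1.a : ℂ) * x + g.1.a * y + 2 * k * z = 1 := mod_cast hxyz
  rw [ha'] at hn
  apply le_antisymm
  · refine Submodule.mul_le.2 fun u hu v hv => ?_
    obtain ⟨p, q, rfl⟩ := mem_lattice.1 hu
    obtain ⟨p', q', rfl⟩ := mem_lattice.1 hv
    -- coordinates with respect to the common second basis vector `k + m √-b`
    refine mem_lattice.2 ⟨(p - q * s) * (p' - q' * t) - q * q' * h.1.c,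
      (p - q * s) * f.1.a * q' + (p' - q' * t) * g.1.a * q + 2 * k * q * q', ?_⟩
    rw [hfb, hgb, hhb, ha']
    push_cast
    linear_combination (q : ℂ) * q' * m ^ 2 * sqrtNeg_sq b - (q : ℂ) * q' * hn
  · intro u hu
    obtain ⟨p, q, rfl⟩ := mem_lattice.1 hu
    have hfβ : (k : ℂ) + m * sqrtNeg b ∈ f.1.lattice b m :=
      mem_lattice.2 ⟨s, 1, by rw [hfb]; push_cast; ring⟩
    have hgβ : (k : ℂ) + m * sqrtNeg b ∈ g.1.lattice b m :=
      mem_lattice.2 ⟨t, 1, by rw [hgb]; push_cast; ring⟩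
    have haa := Submodule.mul_mem_mul (a_mem_lattice b m f.1) (a_mem_lattice b m g.1)
    have hab := Submodule.mul_mem_mul (a_mem_lattice b m f.1) hgβ
    have hba := Submodule.mul_mem_mul hfβ (a_mem_lattice b m g.1)
    have hbb := Submodule.mul_mem_mul hfβ hgβ
    have h1 := add_mem (Submodule.smul_mem _ (p + q * z * h.1.c) haa)
      (add_mem (Submodule.smul_mem _ (q * x) hab)
        (add_mem (Submodule.smul_mem _ (q * y) hba) (Submodule.smul_mem _ (q * z) hbb)))
    convert h1 using 1
    simp only [zsmul_eq_mul]
    rw [hhb, ha']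
    push_cast
    linear_combination (-(q : ℂ) * z * m ^ 2) * sqrtNeg_sq b + (q : ℂ) * z * hn -
      (q : ℂ) * (k + m * sqrtNeg b) * hxyz'

end PrimForm

namespace FormClass

variable {D D' : ℤ} {b : ℕ} {m r : ℤ}

theorem exists_toClass_eq (F : FormClass D) : ∃ f : PrimForm D, f.toClass = F :=
  Quotient.exists_rep F

/-- The derivation map between class groups is extension of lattices to the larger order. -/
theorem IsDerived.homothetic {F : FormClass D'} {G : FormClass D} (h : F.IsDerived r G)
    (hD' : D' = -4 * b * (r * m) ^ 2) (hD : D = -4 * b * m ^ 2)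
    {f : PrimForm D'} {g : PrimForm D} (hf : f.toClass = F) (hg : g.toClass = G) :
    Homothetic (f.1.lattice b (r * m) * order b m) (g.1.lattice b m) := by
  obtain ⟨f', g', A, hf', hg', hA, hfg⟩ := h
  exact ((PrimForm.homothetic_of_toClass_eq hD' (hf.trans hf'.symm)).mul (.refl _)).trans
    ((hfg.homothetic hA (by rw [f'.2.1, hD']) f'.2.2.1 f'.2.2.2
      (by rw [g'.2.1, hD]) g'.2.2.1 g'.2.2.2).trans
    (PrimForm.homothetic_of_toClass_eq hD (hg'.trans hg.symm)))

theorem IsProduct.homothetic {F G H : FormClass D} (h : F.IsProduct G H)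
    (hD : D = -4 * b * m ^ 2) {f g k : PrimForm D}
    (hf : f.toClass = F) (hg : g.toClass = G) (hk : k.toClass = H) :
    Homothetic (k.1.lattice b m) (f.1.lattice b m * g.1.lattice b m) := by
  obtain ⟨f', g', k', hf', hg', hk', hc⟩ := h
  refine (PrimForm.homothetic_of_toClass_eq hD (hk.trans hk'.symm)).trans ?_
  rw [← hc.lattice_mul hD]
  exact (PrimForm.homothetic_of_toClass_eq hD (hf'.trans hf.symm)).mul
    (PrimForm.homothetic_of_toClass_eq hD (hg'.trans hg.symm))

theorem IsPow.homothetic {G H : FormClass D} {k : ℕ} (h : G.IsPow k H)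
    (hD : D = -4 * b * m ^ 2) {f g : PrimForm D} (hf : f.toClass = H) (hg : g.toClass = G) :
    Homothetic (f.1.lattice b m) (g.1.lattice b m ^ k) := by
  induction h generalizing f with
  | one =>
    rw [pow_one]
    exact PrimForm.homothetic_of_toClass_eq hD (hf.trans hg.symm)
  | @succ k H H' _ hp ih =>
    obtain ⟨f', hf'⟩ := exists_toClass_eq H
    rw [pow_succ]
    exact (hp.homothetic hD hf' hg hf).trans ((ih hf').mul (.refl _))

end FormClass

/-! ### The exponent `φ` -/

theorem natCast_dvd_intCast_pow_sub_self (d : ℤ) {r : ℕ} (hr : r.Prime) (x : ℤ) :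
    (r : ℤ√d) ∣ (x : ℤ√d) ^ r - x := by
  have := Fact.mk hr
  have h : (r : ℤ) ∣ x ^ r - x := by
    rw [← ZMod.intCast_zmod_eq_zero_iff_dvd]
    simp
  have h' := map_dvd (Int.castRingHom (ℤ√d)) h
  simpa using h'

/-- The Frobenius on `ℤ[√d] / r` for an odd prime `r`: it is the identity, the conjugation or the
projection to the first coordinate, according to the Legendre symbol. -/
theorem natCast_dvd_pow_sub_of_odd (d : ℤ) {r : ℕ} (hr : r.Prime) (hr2 : r ≠ 2) (x y : ℤ) :
    (r : ℤ√d) ∣ ((x : ℤ√d) + (y : ℤ√d) * Zsqrtd.sqrtd) ^ r -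
      ((x : ℤ√d) + ((jacobiSym d r * y : ℤ) : ℤ√d) * Zsqrtd.sqrtd) := by
  have := Fact.mk hr
  obtain ⟨w, hw⟩ := exists_add_pow_prime_eq hr (x : ℤ√d) ((y : ℤ√d) * Zsqrtd.sqrtd)
  obtain ⟨q, hq⟩ := hr.odd_of_ne_two hr2
  have hq2 : r / 2 = q := by omega
  obtain ⟨u, hu⟩ := natCast_dvd_intCast_pow_sub_self d hr x
  obtain ⟨v, hv⟩ := natCast_dvd_intCast_pow_sub_self d hr y
  have h : (r : ℤ) ∣ d ^ q - jacobiSym d r := by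
    rw [← ZMod.intCast_zmod_eq_zero_iff_dvd, ← jacobiSym.legendreSym.to_jacobiSym, Int.cast_sub,
      legendreSym.eq_pow, hq2]
    simp
  obtain ⟨t, ht⟩ := map_dvd (Int.castRingHom (ℤ√d)) h
  simp only [map_sub, map_pow, map_natCast, eq_intCast] at ht
  have hs : (Zsqrtd.sqrtd : ℤ√d) ^ r = (d : ℤ√d) ^ q * Zsqrtd.sqrtd := by
    rw [hq, pow_succ, pow_mul, pow_two, Zsqrtd.dmuld]
  rw [hw, mul_pow, hs]
  refine ⟨(x : ℤ√d) * ((y : ℤ√d) * Zsqrtd.sqrtd) * w + u + v * (d : ℤ√d) ^ q * Zsqrtd.sqrtd +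
    (y : ℤ√d) * t * Zsqrtd.sqrtd, ?_⟩
  push_cast
  linear_combination hu + hv * d ^ q * Zsqrtd.sqrtd + ht * y * Zsqrtd.sqrtd

/-- The unit group of `ℤ[√d] / r` has exponent dividing `φ(r)` modulo the nonzero integers
modulo `r`. The factor `4 a²`, prime to an odd `r`, does not change the Kronecker symbol. -/
theorem exists_natCast_dvd_pow_phiDisc_sub {D d : ℤ} {a r : ℕ} (hD : D = 4 * a ^ 2 * d)
    (hr : r.Prime) (hra : r.Coprime a) {u v : ℤ√d} {k : ℤ} (hk : ¬(r : ℤ) ∣ k)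
    (huv : (r : ℤ√d) ∣ u * v - k) :
    ∃ l : ℤ, (r : ℤ√d) ∣ u ^ phiDisc D r - l := by
  have hφ : phiDisc D r = ((r : ℤ) - kroneckerPrime D r).toNat := by
    simp [phiDisc, hr.primeFactors, hr.factorization_self]
  obtain ⟨x, y, hu⟩ : ∃ x y : ℤ, u = (x : ℤ√d) + (y : ℤ√d) * Zsqrtd.sqrtd :=
    ⟨u.re, u.im, by ext <;> simp⟩
  have hss : (Zsqrtd.sqrtd : ℤ√d) * Zsqrtd.sqrtd = (d : ℤ√d) := Zsqrtd.dmuld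
  rcases eq_or_ne r 2 with rfl | hr2
  · have h : phiDisc D 2 = 2 := by
      have h2 : kroneckerPrime D 2 = 0 := by
        have h3 : ((4 * a ^ 2 * d : ℤ) : ZMod 8) = 2 * (2 * a ^ 2 * d) := by push_cast; ring
        rw [kroneckerPrime, if_pos rfl, hD, h3]
        generalize (2 * a ^ 2 * d : ZMod 8) = e
        revert e
        decide
      rw [hφ, h2]
      rfl
    rw [h, hu]
    refine ⟨x ^ 2 + y ^ 2 * d, (x : ℤ√d) * (y : ℤ√d) * Zsqrtd.sqrtd, ?_⟩
    push_cast
    linear_combination (y : ℤ√d) ^ 2 * hss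
  · have hj : kroneckerPrime D r = jacobiSym d r := by
      have h2a : ((2 * a : ℤ)).gcd r = 1 := by
        rw [show (2 * a : ℤ) = ((2 * a : ℕ) : ℤ) by push_cast; rfl, Int.gcd_natCast_natCast]
        exact Nat.Coprime.mul_left ((Nat.coprime_primes Nat.prime_two hr).2 hr2.symm) hra.symm
      rw [kroneckerPrime, if_neg hr2, hD, show (4 * a ^ 2 * d : ℤ) = (2 * a) ^ 2 * d by ring,
        jacobiSym.mul_left, jacobiSym.sq_one' h2a, one_mul]
    rw [hφ, hj]
    have hF := natCast_dvd_pow_sub_of_odd d hr hr2 x y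
    rw [← hu] at hF
    rcases jacobiSym.trichotomy d r with h | h | h
    · rw [h] at hF ⊢
      exact ⟨x, by simpa using hF⟩
    · rw [h] at hF ⊢
      have he : ((r : ℤ) - 1).toNat = r - 1 := by omega
      rw [he]
      refine ⟨1, ?_⟩
      have hur : u ^ r = u ^ (r - 1) * u := by rw [← pow_succ, Nat.sub_add_cancel hr.one_le]
      have h1 : (r : ℤ√d) ∣ u ^ r - u := by
        convert hF using 2
        rw [hu, one_mul]
      have hcop : IsCoprime (r : ℤ) k :=
        (Int.prime_iff_natAbs_prime.2 (by simpa using hr)).coprime_iff_not_dvd.2 hk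
      have hcop' := hcop.map (Int.castRingHom (ℤ√d))
      simp only [map_natCast, eq_intCast] at hcop'
      apply hcop'.dvd_of_dvd_mul_right
      -- `u ^ (r - 1) k ≡ u ^ r v ≡ u v ≡ k` modulo `r`
      have h2 : (u ^ (r - 1) - ((1 : ℤ) : ℤ√d)) * k =
          (u ^ r - u) * v - (u ^ (r - 1) - 1) * (u * v - k) := by
        rw [hur]
        push_cast
        ring
      rw [h2]
      exact dvd_sub (h1.mul_right v) (huv.mul_left _)
    · rw [h] at hF ⊢
      have he : ((r : ℤ) - -1).toNat = r + 1 := by omega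
      rw [he]
      refine ⟨x ^ 2 - y ^ 2 * d, ?_⟩
      have h2 : u ^ (r + 1) - ((x ^ 2 - y ^ 2 * d : ℤ) : ℤ√d) =
          (u ^ r - ((x : ℤ√d) + ((-1 * y : ℤ) : ℤ√d) * Zsqrtd.sqrtd)) * u := by
        rw [pow_succ]
        nth_rewrite 4 [hu]
        nth_rewrite 2 [hu]
        push_cast
        linear_combination (-(y : ℤ√d) ^ 2) * hss
      rw [h2]
      exact hF.mul_right u

/-! ### The kernel of the class group map from conductor `r` -/

/-- The embedding of `ℤ[√-b]` into `ℂ`, with image `order b 1`. -/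
noncomputable def zsqrtdToComplex (b : ℕ) : ℤ√(-b : ℤ) →+* ℂ :=
  Zsqrtd.lift ⟨sqrtNeg b, by rw [← pow_two, sqrtNeg_sq]; push_cast; rfl⟩

theorem zsqrtdToComplex_apply (b : ℕ) (u : ℤ√(-b : ℤ)) :
    zsqrtdToComplex b u = u.re + u.im * sqrtNeg b := rfl

theorem zsqrtdToComplex_injective {b : ℕ} (hb : 0 < b) :
    Function.Injective (zsqrtdToComplex b) :=
  Zsqrtd.lift_injective _ fun n => by nlinarith [mul_self_nonneg n]

theorem mem_order_one {b : ℕ} {z : ℂ} : z ∈ order b 1 ↔ ∃ u, zsqrtdToComplex b u = z := by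
  rw [mem_order]
  constructor
  · rintro ⟨x, y, rfl⟩
    exact ⟨⟨x, y⟩, by simp [zsqrtdToComplex_apply]⟩
  · rintro ⟨u, rfl⟩
    exact ⟨u.re, u.im, by simp [zsqrtdToComplex_apply]⟩

theorem order_mul_order_pow (b : ℕ) (m : ℤ) (k : ℕ) : order b m * order b m ^ k = order b m := by
  induction k with
  | zero => simp
  | succ k ih => rw [pow_succ, ← mul_assoc, ih, order_mul_order b dvd_rfl]

theorem order_mul_pow {b : ℕ} {m : ℤ} {L : Submodule ℤ ℂ} (h : L * order b m = order b m) (k : ℕ) :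
    order b m * L ^ k = order b m := by
  induction k with
  | zero => simp
  | succ k ih => rw [pow_succ, ← mul_assoc, ih, mul_comm, h]

theorem le_order {b : ℕ} {m : ℤ} {L : Submodule ℤ ℂ} (h : L * order b m = order b m) :
    L ≤ order b m := by
  calc L = L * 1 := (mul_one _).symm
    _ ≤ L * order b m := mul_le_mul_right (one_le_order b m) _
    _ = order b m := h

theorem multiples_mul_order_one_le (b r : ℕ) : multiples r * order b 1 ≤ order b r := by
  intro z hz
  obtain ⟨w, hw, rfl⟩ := mem_multiples_mul.1 hz
  obtain ⟨x, y, rfl⟩ := mem_order.1 hw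
  exact mem_order.2 ⟨r * x, y, by push_cast; ring⟩

/-- Let `I` be invertible over `ℤ[r √-b]` with extension `ℤ[√-b]` to the larger order. Then `I`
contains an element `x` that is a unit modulo `r`; its `φ(r)`-th power is an integer modulo `r`,
and since
`ℤ[r √-b] I ^ φ(r)` contains `r ℤ[√-b]` as well, it contains `1`. -/
theorem order_le_order_mul_pow_phiDisc {D : ℤ} {a b r : ℕ} (hb : 0 < b)
    (hD : D = 4 * a ^ 2 * (-b : ℤ)) (hr : r.Prime) (hra : r.Coprime a) {I J : Submodule ℤ ℂ}
    (hIJ : I * J = order b r) (hI : I * order b 1 = order b 1) (hJ : J * order b 1 = order b 1) :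
    order b r ≤ order b r * I ^ phiDisc D r := by
  have hrp : Prime (r : ℤ) := Nat.prime_iff_prime_int.1 hr
  have hdvd {k : ℤ} (h : (r : ℤ√(-b : ℤ)) ∣ (k : ℤ√(-b : ℤ))) : (r : ℤ) ∣ k := by
    rw [← Zsqrtd.intCast_dvd_intCast (d := -b)]
    exact mod_cast h
  have hmem {u : ℤ√(-b : ℤ)} :
      zsqrtdToComplex b u ∈ multiples r * order b 1 ↔ (r : ℤ√(-b : ℤ)) ∣ u := by
    rw [mem_multiples_mul]
    constructor
    · rintro ⟨_, hy, hy'⟩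
      obtain ⟨w, rfl⟩ := mem_order_one.1 hy
      refine ⟨w, zsqrtdToComplex_injective hb ?_⟩
      rw [← hy', map_mul, map_natCast]
    · rintro ⟨w, rfl⟩
      exact ⟨_, mem_order_one.2 ⟨w, rfl⟩, by rw [map_mul, map_natCast]⟩
  obtain ⟨x, hx, y, hy, hxy⟩ : ∃ x ∈ I, ∃ y ∈ J, x * y ∉ multiples r * order b 1 := by
    by_contra! h
    have h1 : (1 : ℂ) ∈ multiples r * order b 1 :=
      (hIJ ▸ Submodule.mul_le.2 h : order b r ≤ _) (one_mem_order b r)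
    have h2 := hdvd (k := 1) (by
      rw [Int.cast_one]
      exact hmem.1 (by rwa [map_one]))
    exact hrp.not_dvd_one h2
  obtain ⟨u, rfl⟩ := mem_order_one.1 (le_order hI hx)
  obtain ⟨v, rfl⟩ := mem_order_one.1 (le_order hJ hy)
  rw [← map_mul, hmem] at hxy
  obtain ⟨k, huv⟩ : ∃ k : ℤ, (r : ℤ√(-b : ℤ)) ∣ u * v - k := by
    obtain ⟨k, t, h⟩ := mem_order.1 (hIJ ▸ Submodule.mul_mem_mul hx hy)
    refine ⟨k, ⟨0, t⟩, zsqrtdToComplex_injective hb ?_⟩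
    rw [map_sub, map_mul, map_mul, h, map_intCast, map_natCast, zsqrtdToComplex_apply]
    push_cast
    ring
  have hk : ¬(r : ℤ) ∣ k := fun h => hxy <| by
    have h' := map_dvd (Int.castRingHom (ℤ√(-b : ℤ))) h
    simp only [map_natCast, eq_intCast] at h'
    exact (dvd_sub_left h').1 huv
  obtain ⟨l, hl⟩ := exists_natCast_dvd_pow_phiDisc_sub hD hr hra hk huv
  have hrl : ¬(r : ℤ) ∣ l := fun h => hk <| by
    have h' := map_dvd (Int.castRingHom (ℤ√(-b : ℤ))) h
    simp only [map_natCast, eq_intCast] at h'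
    have h1 : (r : ℤ√(-b : ℤ)) ∣ (u * v) ^ phiDisc D r := by
      rw [mul_pow]
      exact ((dvd_sub_left h').1 hl).mul_right _
    have h2 := (dvd_sub_right h1).1 (huv.trans (sub_dvd_pow_sub_pow _ _ (phiDisc D r)))
    exact hrp.dvd_of_dvd_pow (hdvd (by exact_mod_cast h2))
  set P := order b r * I ^ phiDisc D r with hP
  have hrP : multiples r * order b 1 ≤ P := by
    rw [← order_mul_pow hI (phiDisc D r), ← mul_assoc, hP]
    exact mul_le_mul_left (multiples_mul_order_one_le b r) _
  have huP : zsqrtdToComplex b u ^ phiDisc D r ∈ P := by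
    rw [← one_mul (_ ^ _)]
    exact Submodule.mul_mem_mul (one_mem_order b r) (Submodule.pow_mem_pow _ hx _)
  have hlP : (l : ℂ) ∈ P := by
    have h := sub_mem huP (hrP (hmem.2 hl))
    simpa using h
  have hrP' : (r : ℂ) ∈ P := hrP <| by
    simpa using multiples_mul_mem (z := (r : ℂ)) (one_mem_order b 1)
  obtain ⟨p, q, hpq⟩ := hrp.coprime_iff_not_dvd.2 hrl
  have h1P : (1 : ℂ) ∈ P := by
    have h := add_mem (Submodule.smul_mem _ p hrP') (Submodule.smul_mem _ q hlP)
    have h' : (p : ℂ) * r + q * l = 1 := mod_cast hpq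
    simpa only [zsmul_eq_mul, h'] using h
  calc order b r = order b r * 1 := (mul_one _).symm
    _ ≤ order b r * P := mul_le_mul_right (Submodule.one_le.2 h1P) _
    _ = P := by rw [hP, ← mul_assoc, order_mul_order b dvd_rfl]

/-- The kernel of the map of class groups from conductor `r` to conductor `1` is killed by
`φ(r)`, in the form of an equality of lattices. -/
theorem order_mul_pow_phiDisc {D : ℤ} {a b r : ℕ} (hb : 0 < b)
    (hD : D = 4 * a ^ 2 * (-b : ℤ)) (hr : r.Prime) (hra : r.Coprime a) {I J : Submodule ℤ ℂ}
    (hIJ : I * J = order b r) (hI : I * order b 1 = order b 1) :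
    order b r * I ^ phiDisc D r = order b r := by
  have hJ : J * order b 1 = order b 1 := by
    calc J * order b 1 = J * (I * order b 1) := by rw [hI]
      _ = I * J * order b 1 := by ring
      _ = order b 1 := by rw [hIJ, order_mul_order b (one_dvd _)]
  apply le_antisymm
  · calc order b r * I ^ phiDisc D r = I ^ phiDisc D r * order b r := mul_comm _ _
      _ ≤ I ^ phiDisc D r * (order b r * J ^ phiDisc D r) :=
        mul_le_mul_right (order_le_order_mul_pow_phiDisc hb hD hr hra
          (by rw [mul_comm, hIJ]) hJ hI) _
      _ = order b r * (I * J) ^ phiDisc D r := by rw [mul_pow]; ring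
      _ = order b r := by rw [hIJ, order_mul_order_pow]
  · exact order_le_order_mul_pow_phiDisc hb hD hr hra hIJ hI hJ

/-- Two lattices of norms `α₁`, `α₂` over a suborder of `ℤ[r √-b]`, with homothetic extensions to
`ℤ[√-b]`: the extensions to `ℤ[r √-b]` of their `φ(r)`-th powers are homothetic. -/
theorem homothetic_pow_phiDisc {D : ℤ} {a b r : ℕ} {m α₁ α₂ : ℤ} (hb : 0 < b)
    (hD : D = 4 * a ^ 2 * (-b : ℤ)) (hr : r.Prime) (hra : r.Coprime a)
    (hm : (r : ℤ) ∣ m) (hα₁ : α₁ ≠ 0) (hα₂ : α₂ ≠ 0) {G₁ G₂ : Submodule ℤ ℂ}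
    (h₁ : G₁ * conjLattice G₁ = multiples α₁ * order b m)
    (h₂ : G₂ * conjLattice G₂ = multiples α₂ * order b m)
    (h : Homothetic (G₁ * order b 1) (G₂ * order b 1)) :
    Homothetic (G₁ ^ phiDisc D r * order b r) (G₂ ^ phiDisc D r * order b r) := by
  obtain ⟨z, hz, h⟩ := h
  have hα₁' : (α₁ : ℂ) ≠ 0 := mod_cast hα₁
  have hα₂' : (α₂ : ℂ) ≠ 0 := mod_cast hα₂
  -- `t` generates the extension of `G₁ * conjLattice G₂` to `ℤ[√-b]`
  set t : ℂ := z * α₂ with ht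
  have ht0 : t ≠ 0 := mul_ne_zero hz hα₂'
  have hmr := order_mul_order b hm
  have hrr := order_mul_order b (dvd_refl (r : ℤ))
  have hm1 := order_mul_order b (one_dvd m)
  have hr1 := order_mul_order b (one_dvd (r : ℤ))
  have hI : multiples t⁻¹ * (G₁ * conjLattice G₂) * order b r * order b 1 = order b 1 := by
    calc multiples t⁻¹ * (G₁ * conjLattice G₂) * order b r * order b 1
        = multiples t⁻¹ * conjLattice G₂ * (G₁ * (order b r * order b 1)) := by ring
      _ = multiples t⁻¹ * multiples z * (G₂ * conjLattice G₂) * order b 1 := by rw [hr1, h]; ring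
      _ = multiples t⁻¹ * multiples t * (order b m * order b 1) := by
        rw [h₂, ht, multiples_mul z]; ring
      _ = order b 1 := by rw [multiples_inv_mul ht0, hm1, one_mul]
  have hIJ : multiples t⁻¹ * (G₁ * conjLattice G₂) * order b r *
      (multiples t * multiples ((α₁ : ℂ)⁻¹) * multiples ((α₂ : ℂ)⁻¹) * (conjLattice G₁ * G₂)) =
        order b r := by
    calc _ = (multiples t⁻¹ * multiples t) * (multiples ((α₁ : ℂ)⁻¹) * multiples ((α₂ : ℂ)⁻¹)) *
          ((G₁ * conjLattice G₁) * (G₂ * conjLattice G₂)) * order b r := by ring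
      _ = (multiples t⁻¹ * multiples t) * (multiples ((α₁ : ℂ)⁻¹) * multiples (α₁ : ℂ)) *
          (multiples ((α₂ : ℂ)⁻¹) * multiples (α₂ : ℂ)) *
            (order b m * (order b m * order b r)) := by rw [h₁, h₂]; ring
      _ = order b r := by
        rw [multiples_inv_mul ht0, multiples_inv_mul hα₁', multiples_inv_mul hα₂', hmr, hmr]
        simp
  have key := order_mul_pow_phiDisc hb hD hr hra hIJ hI
  generalize phiDisc D r = k at key ⊢
  have key' : order b r * (G₁ * conjLattice G₂) ^ k = multiples (t ^ k) * order b r := by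
    apply multiples_mul_cancel (pow_ne_zero k (inv_ne_zero ht0))
    calc multiples (t⁻¹ ^ k) * (order b r * (G₁ * conjLattice G₂) ^ k)
        = multiples t⁻¹ ^ k * (G₁ * conjLattice G₂) ^ k * (order b r * order b r ^ k) := by
          rw [order_mul_order_pow, multiples_pow]; ring
      _ = order b r * (multiples t⁻¹ * (G₁ * conjLattice G₂) * order b r) ^ k := by
          rw [mul_pow, mul_pow]; ring
      _ = (multiples t⁻¹ * multiples t) ^ k * order b r := by
          rw [key, multiples_inv_mul ht0, one_pow, one_mul]
      _ = multiples (t⁻¹ ^ k) * (multiples (t ^ k) * order b r) := by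
          rw [multiples_pow, multiples_pow, mul_pow, mul_assoc]
  refine ⟨z ^ k, pow_ne_zero k hz, ?_⟩
  apply multiples_mul_cancel (pow_ne_zero k hα₂')
  calc multiples ((α₂ : ℂ) ^ k) * (G₁ ^ k * order b r)
      = G₁ ^ k * multiples (α₂ : ℂ) ^ k * (order b m * (order b r * order b m ^ k)) := by
        have : order b r * order b m ^ k = order b r := by
          clear key key'
          induction k with
          | zero => simp
          | succ k ih => rw [pow_succ, ← mul_assoc, ih, mul_comm, hmr]
        rw [this, hmr, multiples_pow]; ring
    _ = G₁ ^ k * (multiples (α₂ : ℂ) * order b m) ^ k * (order b m * order b r) := by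
        rw [mul_pow]; ring
    _ = (order b r * (G₁ * conjLattice G₂) ^ k) * G₂ ^ k := by
        rw [← h₂, hmr, mul_pow, mul_pow]; ring
    _ = multiples ((α₂ : ℂ) ^ k) * (multiples (z ^ k) * (G₂ ^ k * order b r)) := by
        rw [key', ht, mul_pow, multiples_mul]; ring

/-! ### Representation of the product of the leading coefficients -/

theorem exists_eval_principal_eq_normSq {b : ℕ} {r : ℤ} {w : ℂ} (hw : w ∈ order b r) :
    ∃ x y : ℤ, w * starRingEnd ℂ w = ((BinForm.principal (b * r ^ 2)).eval x y : ℤ) := by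
  obtain ⟨x, y, rfl⟩ := mem_order.1 hw
  refine ⟨x, y, ?_⟩
  simp only [map_add, map_mul, map_intCast, conj_sqrtNeg, BinForm.principal, BinForm.eval]
  push_cast
  linear_combination (-(y : ℂ) ^ 2 * r ^ 2) * sqrtNeg_sq b

/-- A positive real scaling that fixes an order is trivial. -/
theorem eq_of_multiples_mul_order_eq {b : ℕ} {m : ℤ} {s t : ℝ} (hs : 0 < s) (ht : 0 < t)
    (h : multiples s * order b m = multiples t * order b m) : s = t := by
  have key {s t : ℝ} (hs : 0 < s) (ht : 0 < t)
      (h : multiples s * order b m = multiples t * order b m) : t ≤ s := by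
    have h1 : (s : ℂ) ∈ multiples t * order b m := by
      rw [← h]
      simpa using multiples_mul_mem (z := (s : ℂ)) (one_mem_order b m)
    obtain ⟨w, hw, hw'⟩ := mem_multiples_mul.1 h1
    obtain ⟨x, y, rfl⟩ := mem_order.1 hw
    have h2 : t * x = s := by
      have := congrArg Complex.re hw'
      simpa [sqrtNeg] using this
    have hx : 0 < x := by
      by_contra hx
      have : (x : ℝ) ≤ 0 := mod_cast not_lt.1 hx
      nlinarith
    have hx' : (1 : ℝ) ≤ x := mod_cast hx
    nlinarith
  exact le_antisymm (key ht hs h.symm) (key hs ht h)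

/-- If two homothetic invertible lattices over `ℤ[r √-b]` contain their own norms `α₁` and `α₂`,
then `α₁ α₂` is the norm of an element of this order: for `Q₁ = z Q₂` one has
`α₁ α₂ ∈ Q₁ * conjLattice Q₂ = z α₂ ℤ[r √-b]` and `|z|² α₂ = α₁`. -/
theorem represents_of_homothetic {b : ℕ} {r α₁ α₂ : ℤ} (hα₁ : 0 < α₁) (hα₂ : 0 < α₂)
    {Q₁ Q₂ : Submodule ℤ ℂ} (h₁ : Q₁ * conjLattice Q₁ = multiples α₁ * order b r)
    (h₂ : Q₂ * conjLattice Q₂ = multiples α₂ * order b r)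
    (hm₁ : (α₁ : ℂ) ∈ Q₁) (hm₂ : (α₂ : ℂ) ∈ Q₂) (h : Homothetic Q₁ Q₂) :
    (BinForm.principal (b * r ^ 2)).Represents (α₁ * α₂) := by
  obtain ⟨z, hz, rfl⟩ := h
  have hα₁' : (0 : ℝ) < α₁ := mod_cast hα₁
  have hα₂' : (0 : ℝ) < α₂ := mod_cast hα₂
  have hα₂c : (α₂ : ℂ) ≠ 0 := mod_cast hα₂.ne'
  have hnorm : z * starRingEnd ℂ z * α₂ = α₁ := by
    have h3 : multiples ((Complex.normSq z * α₂ : ℝ) : ℂ) * order b r =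
        multiples ((α₁ : ℝ) : ℂ) * order b r := by
      have e : ((Complex.normSq z * α₂ : ℝ) : ℂ) = z * starRingEnd ℂ z * α₂ := by
        rw [Complex.mul_conj]
        push_cast
        ring
      rw [e, multiples_mul, mul_assoc, ← h₂, multiples_mul, ← conjLattice_multiples,
        Complex.ofReal_intCast, ← h₁, map_mul]
      ring
    have h4 := eq_of_multiples_mul_order_eq (mul_pos (Complex.normSq_pos.2 hz) hα₂') hα₁' h3
    rw [Complex.mul_conj]
    exact mod_cast h4
  have hmem : (α₁ : ℂ) * α₂ ∈ multiples (z * α₂) * order b r := by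
    have h5 := Submodule.mul_mem_mul hm₁ (conj_mem_conjLattice hm₂)
    rwa [map_intCast, mul_assoc, h₂, ← mul_assoc, ← multiples_mul] at h5
  obtain ⟨w, hw, hw'⟩ := mem_multiples_mul.1 hmem
  obtain ⟨x, y, hxy⟩ := exists_eval_principal_eq_normSq hw
  refine ⟨x, y, ?_⟩
  have hzw : z * w = α₁ := mul_left_cancel₀ hα₂c (by linear_combination hw')
  have hzw' : starRingEnd ℂ z * starRingEnd ℂ w = α₁ := by
    rw [← map_mul, hzw, map_intCast]
  have hα₁c : (α₁ : ℂ) ≠ 0 := mod_cast hα₁.ne'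
  have h6 : w * starRingEnd ℂ w = α₁ * α₂ := by
    apply mul_left_cancel₀ hα₁c
    linear_combination (-(w * starRingEnd ℂ w)) * hnorm +
      (α₂ : ℂ) * starRingEnd ℂ z * starRingEnd ℂ w * hzw + (α₁ : ℂ) * α₂ * hzw'
  rw [hxy] at h6
  exact mod_cast h6

theorem mainTheorem7 (n a b r : ℕ) (hn_pos : 0 < n) (hn : n = a ^ 2 * b)
    (hr : r.Prime) (hra : Nat.Coprime r a)
    (f₀ : FormClass (-4 * (b : ℤ))) (f₁ f₂ : FormClass (-4 * (n : ℤ)))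
    (hf₁ : f₁.IsDerived (a : ℤ) f₀) (hf₂ : f₂.IsDerived (a : ℤ) f₀)
    (g₁ g₂ : FormClass (-4 * (n : ℤ) * (r : ℤ) ^ 2))
    (hg₁ : g₁.IsDerived (r : ℤ) f₁) (hg₂ : g₂.IsDerived (r : ℤ) f₂)
    (h₁ h₂ : FormClass (-4 * (n : ℤ) * (r : ℤ) ^ 2))
    (hh₁ : g₁.IsPow (phiDisc (-4 * (n : ℤ)) r) h₁)
    (hh₂ : g₂.IsPow (phiDisc (-4 * (n : ℤ)) r) h₂)
    (F₁ F₂ : PrimForm (-4 * (n : ℤ) * (r : ℤ) ^ 2))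
    (hF₁ : F₁.toClass = h₁) (hF₂ : F₂.toClass = h₂) :
    (BinForm.principal ((b : ℤ) * (r : ℤ) ^ 2)).Represents (F₁.1.a * F₂.1.a) := by
  have hb : 0 < b := Nat.pos_of_ne_zero fun h => by simp [hn, h] at hn_pos
  have hD₀ : -4 * (b : ℤ) = -4 * b * (1 : ℤ) ^ 2 := by ring
  have hD₁ : -4 * (n : ℤ) = -4 * b * (a * 1 : ℤ) ^ 2 := by rw [hn]; push_cast; ring
  have hD₂ : -4 * (n : ℤ) * (r : ℤ) ^ 2 = -4 * b * (r * (a * 1) : ℤ) ^ 2 := by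
    rw [hn]; push_cast; ring
  have hrm : (r : ℤ) ∣ r * (a * 1) := dvd_mul_right _ _
  obtain ⟨G₁, rfl⟩ := g₁.exists_toClass_eq
  obtain ⟨G₂, rfl⟩ := g₂.exists_toClass_eq
  obtain ⟨E₀, rfl⟩ := f₀.exists_toClass_eq
  -- extending the lattice of `gᵢ` to `ℤ[√-b]` goes through the class `fᵢ` and ends in `f₀`
  have hext {f : FormClass (-4 * (n : ℤ))} {G : PrimForm (-4 * (n : ℤ) * (r : ℤ) ^ 2)}
      (hf : f.IsDerived (a : ℤ) E₀.toClass) (hG : G.toClass.IsDerived (r : ℤ) f) :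
      Homothetic (G.1.lattice b (r * (a * 1)) * order b 1) (E₀.1.lattice b 1) := by
    obtain ⟨E, rfl⟩ := f.exists_toClass_eq
    have e := (hG.homothetic hD₂ hD₁ rfl rfl).mul (.refl (order b 1))
    rw [mul_assoc, order_mul_order b (one_dvd _)] at e
    exact e.trans (hf.homothetic hD₁ hD₀ rfl rfl)
  have hnorm (G : PrimForm (-4 * (n : ℤ) * (r : ℤ) ^ 2)) :
      G.1.lattice b (r * (a * 1)) * conjLattice (G.1.lattice b (r * (a * 1))) =
        multiples G.1.a * order b (r * (a * 1)) :=
    BinForm.lattice_mul_conjLattice (G.2.1.trans hD₂) G.2.2.1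
  have hnorm' (G : PrimForm (-4 * (n : ℤ) * (r : ℤ) ^ 2)) :
      G.1.lattice b (r * (a * 1)) * order b r *
        conjLattice (G.1.lattice b (r * (a * 1)) * order b r) = multiples G.1.a * order b r := by
    calc _ = G.1.lattice b (r * (a * 1)) * conjLattice (G.1.lattice b (r * (a * 1))) *
          (order b r * order b r) := by rw [map_mul, conjLattice_order]; ring
      _ = multiples G.1.a * order b r := by
        rw [hnorm, order_mul_order b dvd_rfl, mul_assoc, order_mul_order b hrm]
  have hmem (G : PrimForm (-4 * (n : ℤ) * (r : ℤ) ^ 2)) :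
      (G.1.a : ℂ) ∈ G.1.lattice b (r * (a * 1)) * order b r := by
    simpa using Submodule.mul_mem_mul (BinForm.a_mem_lattice b (r * (a * 1)) G.1)
      (one_mem_order b r)
  have hG := homothetic_pow_phiDisc hb (D := -4 * (n : ℤ)) (a := a)
    (by rw [hn]; push_cast; ring) hr hra hrm G₁.2.2.2.ne' G₂.2.2.2.ne' (hnorm G₁) (hnorm G₂)
    ((hext hf₁ hg₁).trans (hext hf₂ hg₂).symm)
  have hF := (((hh₁.homothetic hD₂ hF₁ rfl).mul (.refl (order b r))).trans hG).trans
    ((hh₂.homothetic hD₂ hF₂ rfl).mul (.refl (order b r))).symm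
  exact represents_of_homothetic F₁.2.2.2 F₂.2.2.2 (hnorm' F₁) (hnorm' F₂) (hmem F₁) (hmem F₂) hF
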